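/- **Setting.** Let $M\ge 2$ be an integer and let $\tau_1,\dots,\tau_N$ be sporadic tasks with worst-case execution times $C_i>0$, relative deadlines $D_i>0$ and minimum inter-arrival times $T_i>0$ (arbitrary deadlines: no relation between $D_i$ and $T_i$ is required). The tasks are indexed by decreasing priority, and the priorities are deadline-monotonic (DM): $D_i\le D_j$ for $i<j$, ties being broken arbitrarily. The task set is *feasible on $M$ unit-speed processors* if for every legal arrival sequence (consecutive jobs of $\tau_i$ arrive at least $T_i$ apart) there is a preemptive schedule with free migration on $M$ processors, in which at each instant at most one job of each task is executed and on at most one processor, and no job is executed before its arrival, such that each job of $\tau_i$ arriving at $a$ receives $C_i$ units of execution in $[a,a+D_i)$. Running the platform at speed $s$ replaces each $C_i$ by $C_i/s$. **Notation.** $U_i=C_i/T_i$, $\delta_i=C_i/\min\{D_i,T_i\}$, $U^{\max}_{\delta,k}=\max\{\max_{i<k}U_i,\ \delta_k\}$, $\mu(\rho)=M-(M-1)\rho$, $D'_{k,\ell}=(\ell-1)T_k+D_k$. For $t\ge 0$, $$work_i(t)=\lfloor t/T_i\rfloor C_i+\min\{C_i,\ t-\lfloor t/T_i\rfloor T_i\}.$$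 For $\Delta>0$ let $\omega^{heavy}_i(\Delta)=work_i(\Delta+D_i)$; let $\omega^{light}_i(\Delta,\rho)=\Delta$ if $\Delta\le C_i$, and otherwise $$\omega^{light}_i(\Delta,\rho)=\max\{work_i(\Delta),\ (p+1)C_i+\max\{0,\,C_i-\rho(T_i-q)\}\},$$ where $p=\lceil(\Delta-C_i)/T_i\rceil-1$ and $q=\Delta-C_i-pT_i$. Let $\omega^{diff}_i(\Delta,\rho)$ be $\omega^{heavy}_i(\Delta)-work_i(\Delta)$ if $U_i>\rho$, and $\omega^{light}_i(\Delta,\rho)-work_i(\Delta)$ if $U_i\le\rho$. Let $\gamma_i(\rho)=1$ if $U_i>\rho$ and $\gamma_i(\rho)=0$ otherwise. For a function $f$ on the tasks, let $\mathrm{Top}_\rho f$ denote the sum of its $\lceil\mu(\rho)\rceil-1$ largest values over $\{1,\dots,k-1\}$ (of all $k-1$ values if there are fewer). **Tests.** Each of the following conditions is a schedulability test for the task $\tau_k$ under global fixed-priority scheduling. 1. For all integers $\ell\ge1$ there is $\rho$ with $\ell C_k/D'_{k,\ell}\le\rho\le1$ such that for all $\Delta\ge D'_{k,\ell}$: $$\ell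 C_k+\mathrm{Top}_\rho\big(\omega^{diff}_i(\Delta,\rho)\big)+\sum_{i<k}work_i(\Delta)\le\Delta\,\mu(\rho).$$ 2. For all integers $\ell\ge1$ there is $\rho$ with $\ell C_k/D'_{k,\ell}\le\rho\le1$ such that $$\frac{\ell C_k}{D'_{k,\ell}}+\frac{\mathrm{Top}_\rho\big(\gamma_i(\rho)U_iD_i\big)}{D'_{k,\ell}}+\sum_{i<k}\Big(\frac{C_i-C_iU_i}{D'_{k,\ell}}+U_i\Big)\le\mu(\rho).$$ 3. For all integers $\ell\ge1$: $$\frac{\ell C_k}{D'_{k,\ell}}+\sum_{i<k}\Big(\frac{C_i-C_iU_i}{D'_{k,\ell}}+U_i\Big)\le\mu(U^{\max}_{\delta,k}).$$ 4. With $b=(D_k-T_k)/T_k$: if $bU_k-\sum_{i<k}\frac{C_i-C_iU_i}{T_k}>0$, then $\sum_{i\le k}U_i\le\mu(U^{\max}_{\delta,k})$; otherwise $\frac{C_k}{D_k}+\sum_{i<k}\big(\frac{C_i-C_iU_i}{D_k}+U_i\big)\le\mu(U^{\max}_{\delta,k})$. 5. $\displaystyle\delta_k+\sum_{i<k}\Big(\frac{C_i-C_iU_i}{D_k}+U_i\Big)\le\mu(U^{\max}_{\delta,k}).$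 **Theorem.** For global DM scheduling on $M\ge2$ processors, each of the five tests has speedup bound $3-\frac1M$ with respect to the optimal schedule. That is, if a task set indexed in DM order is feasible on $M$ unit-speed processors, then each of the tests, applied with all execution times $C_i$ replaced by $C_i/(3-\frac1M)$, accepts every task $\tau_k$, $1\le k\le N$. -/

import Mathlib

noncomputable section

namespace Sporadic

/-- Parameters of `N` sporadic tasks: worst-case execution time `C i`, relative deadline `D i`
and minimum inter-arrival time (period) `T i`.  Priorities are given by the index: task `i` has
higher priority than task `j` iff `i < j`.  No relation between `D i` and `T i` is required
(arbitrary deadlines). -/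
structure TaskSet (N : ℕ) where
  C : Fin N → ℝ
  D : Fin N → ℝ
  T : Fin N → ℝ

namespace TaskSet

variable {N : ℕ}

/-- All parameters are positive. -/
def Positive (τ : TaskSet N) : Prop :=
  ∀ i, 0 < τ.C i ∧ 0 < τ.D i ∧ 0 < τ.T i

/-- The index order is a deadline-monotonic priority order (ties broken arbitrarily). -/
def IsDeadlineMonotonic (τ : TaskSet N) : Prop :=
  ∀ i j, i < j → τ.D i ≤ τ.D j

/-- The task set as seen on a platform of speed `s`: execution times become `C i / s`. -/
def atSpeed (τ : TaskSet N) (s : ℝ) : TaskSet N where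
  C := fun i => τ.C i / s
  D := τ.D
  T := τ.T

/-- Utilization `U i = C i / T i`. -/
def U (τ : TaskSet N) (i : Fin N) : ℝ := τ.C i / τ.T i

/-- Density `δ i = C i / min (D i) (T i)`. -/
def density (τ : TaskSet N) (i : Fin N) : ℝ := τ.C i / min (τ.D i) (τ.T i)

/-- The maximum of the density of task `k` and the utilizations of the tasks `i < k`. -/
def Umax (τ : TaskSet N) (k : Fin N) : ℝ :=
  (Finset.Iio k).fold max (τ.density k) τ.U

end TaskSet

/-! ### Feasibility on `M` identical unit-speed processors -/

/-- A legal arrival sequence: `r i n` is the arrival time of the `n`-th job of task `i`, and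
consecutive arrivals of jobs of task `i` are separated by at least `T i`. -/
def IsLegalArrival {N : ℕ} (τ : TaskSet N) (r : Fin N → ℕ → ℝ) : Prop :=
  ∀ i, 0 ≤ r i 0 ∧ ∀ n, r i n + τ.T i ≤ r i (n + 1)

/-- A preemptive schedule with free migration on `M` processors: `run p t` is the job (task and
job number) that processor `p` executes at time `t`, or `none` if `p` idles.  At each instant at
most one job of each task is executed, on at most one processor (no intra-task parallelism). -/
structure Schedule (M N : ℕ) where
  run : Fin M → ℝ → Option (Fin N × ℕ)
  measurableSet_run : ∀ p i n, MeasurableSet {t | run p t = some (i, n)}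
  no_parallelism : ∀ t p p' i n n',
    run p t = some (i, n) → run p' t = some (i, n') → p = p'

/-- The amount of execution that the `n`-th job of task `i` receives in `[a, b)` (at speed 1). -/
def Schedule.service {M N : ℕ} (σ : Schedule M N) (i : Fin N) (n : ℕ) (a b : ℝ) : ENNReal :=
  ∑ p, MeasureTheory.volume ({t | σ.run p t = some (i, n)} ∩ Set.Ico a b)

/-- The schedule serves the arrival sequence `r`: no job is executed before it arrives, and each
job receives its worst-case execution time between its arrival and its absolute deadline. -/
def Schedule.MeetsDeadlines {M N : ℕ} (σ : Schedule M N) (τ : TaskSet N)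
    (r : Fin N → ℕ → ℝ) : Prop :=
  (∀ p t i n, σ.run p t = some (i, n) → r i n ≤ t) ∧
  ∀ i n, ENNReal.ofReal (τ.C i) ≤ σ.service i n (r i n) (r i n + τ.D i)

/-- An optimal (clairvoyant) scheduler meets all deadlines on `M` unit-speed processors:
every legal arrival sequence has a schedule in which all jobs meet their deadlines. -/
def Feasible {N : ℕ} (M : ℕ) (τ : TaskSet N) : Prop :=
  ∀ r, IsLegalArrival τ r → ∃ σ : Schedule M N, σ.MeetsDeadlines τ r

/-! ### Workload functions -/

namespace TaskSet

variable {N : ℕ}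

/-- The workload function `work i t` (used for `t ≥ 0` only). -/
def work (τ : TaskSet N) (i : Fin N) (t : ℝ) : ℝ :=
  (⌊t / τ.T i⌋ : ℝ) * τ.C i + min (τ.C i) (t - (⌊t / τ.T i⌋ : ℝ) * τ.T i)

/-- Carry-in workload of a heavy task. -/
def heavy (τ : TaskSet N) (i : Fin N) (Δ : ℝ) : ℝ := τ.work i (Δ + τ.D i)

/-- Carry-in workload of a light task, for `Δ > 0`, with
`p₂ = ⌈(Δ - C i) / T i⌉ - 1` and `q₂ = Δ - C i - p₂ T i`. -/
def light (τ : TaskSet N) (i : Fin N) (ρ Δ : ℝ) : ℝ :=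
  if Δ ≤ τ.C i then Δ
  else
    let p₂ : ℝ := (⌈(Δ - τ.C i) / τ.T i⌉ : ℝ) - 1
    let q₂ : ℝ := Δ - τ.C i - p₂ * τ.T i
    max (τ.work i Δ) ((p₂ + 1) * τ.C i + max 0 (τ.C i - ρ * (τ.T i - q₂)))

open Classical in
/-- The additional workload of task `i` if it is a carry-in task. -/
def omegaDiff (τ : TaskSet N) (i : Fin N) (ρ Δ : ℝ) : ℝ :=
  if ρ < τ.U i then τ.heavy i Δ - τ.work i Δ else τ.light i ρ Δ - τ.work i Δ

open Classical in
/-- `γ i = 1` if `U i > ρ` and `γ i = 0` otherwise. -/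
def gamma (τ : TaskSet N) (i : Fin N) (ρ : ℝ) : ℝ := if ρ < τ.U i then 1 else 0

end TaskSet

/-- `μ = M - (M - 1) ρ`. -/
def mu (M : ℕ) (ρ : ℝ) : ℝ := (M : ℝ) - ((M : ℝ) - 1) * ρ

/-- `S` consists of the `m` elements of `A` with the largest values of `f`
(all of `A` if `A` has fewer than `m` elements; ties are broken arbitrarily). -/
def IsLargest {ι : Type*} (A : Finset ι) (f : ι → ℝ) (m : ℕ) (S : Finset ι) : Prop :=
  S ⊆ A ∧ S.card = min m A.card ∧ ∀ i ∈ S, ∀ j ∈ A, j ∉ S → f j ≤ f i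

/-- The `ℓ`-job window length `D'_k = (ℓ - 1) T_k + D_k`. -/
def TaskSet.window {N : ℕ} (τ : TaskSet N) (k : Fin N) (ℓ : ℕ) : ℝ :=
  ((ℓ : ℝ) - 1) * τ.T k + τ.D k

/-! ### The schedulability tests

Each is a condition on `M` processors, a task set and the task `k` under analysis; the
higher-priority tasks are those in `Finset.Iio k`. -/

/-- The test with exact workload functions. -/
def workloadTest (N M : ℕ) (τ : TaskSet N) (k : Fin N) : Prop :=
  ∀ ℓ : ℕ, 1 ≤ ℓ → ∃ ρ : ℝ, ρ ≤ 1 ∧ (ℓ : ℝ) * τ.C k / τ.window k ℓ ≤ ρ ∧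
    ∀ Δ : ℝ, τ.window k ℓ ≤ Δ →
      ∃ S : Finset (Fin N),
        IsLargest (Finset.Iio k) (fun i => τ.omegaDiff i ρ Δ) (⌈mu M ρ⌉₊ - 1) S ∧
        (ℓ : ℝ) * τ.C k + ∑ i ∈ S, τ.omegaDiff i ρ Δ + ∑ i ∈ Finset.Iio k, τ.work i Δ
          ≤ Δ * mu M ρ

/-- The test with linear approximations of the workload functions. -/
def linearApproxTest (N M : ℕ) (τ : TaskSet N) (k : Fin N) : Prop :=
  ∀ ℓ : ℕ, 1 ≤ ℓ → ∃ ρ : ℝ, ρ ≤ 1 ∧ (ℓ : ℝ) * τ.C k / τ.window k ℓ ≤ ρ ∧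
    ∃ S : Finset (Fin N),
      IsLargest (Finset.Iio k) (fun i => τ.gamma i ρ * τ.U i * τ.D i) (⌈mu M ρ⌉₊ - 1) S ∧
      (ℓ : ℝ) * τ.C k / τ.window k ℓ
        + ∑ i ∈ S, τ.gamma i ρ * τ.U i * τ.D i / τ.window k ℓ
        + ∑ i ∈ Finset.Iio k, ((τ.C i - τ.C i * τ.U i) / τ.window k ℓ + τ.U i)
        ≤ mu M ρ

/-- The test with `ρ` set to `Umax k`, for all `ℓ`. -/
def allEllTest (N M : ℕ) (τ : TaskSet N) (k : Fin N) : Prop :=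
  ∀ ℓ : ℕ, 1 ≤ ℓ →
    (ℓ : ℝ) * τ.C k / τ.window k ℓ
      + ∑ i ∈ Finset.Iio k, ((τ.C i - τ.C i * τ.U i) / τ.window k ℓ + τ.U i)
      ≤ mu M (τ.Umax k)

/-- The condition of the two-case closed-form test (the worst case is `ℓ → ∞` or `ℓ = 1`). -/
def closedFormTest (N M : ℕ) (τ : TaskSet N) (k : Fin N) : Prop :=
  let b : ℝ := (τ.D k - τ.T k) / τ.T k
  (0 < b * τ.U k - ∑ i ∈ Finset.Iio k, (τ.C i - τ.C i * τ.U i) / τ.T k →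
    ∑ i ∈ Finset.Iic k, τ.U i ≤ mu M (τ.Umax k)) ∧
  (¬ 0 < b * τ.U k - ∑ i ∈ Finset.Iio k, (τ.C i - τ.C i * τ.U i) / τ.T k →
    τ.C k / τ.D k + ∑ i ∈ Finset.Iio k, ((τ.C i - τ.C i * τ.U i) / τ.D k + τ.U i)
      ≤ mu M (τ.Umax k))

/-- The linear-time density-based test. -/
def densityTest (N M : ℕ) (τ : TaskSet N) (k : Fin N) : Prop :=
  τ.density k + ∑ i ∈ Finset.Iio k, ((τ.C i - τ.C i * τ.U i) / τ.D k + τ.U i)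
    ≤ mu M (τ.Umax k)

/-- A schedulability test has speedup bound `s` for global deadline-monotonic scheduling on `M`
processors, with respect to the optimal schedule: whenever a task set, indexed in
deadline-monotonic priority order, can be feasibly scheduled by some scheduler on `M` processors
of speed `1`, the test deems every task schedulable when all processors run at speed `s`. -/
def HasSpeedupBoundDM (M : ℕ) (test : (N M : ℕ) → TaskSet N → Fin N → Prop) (s : ℝ) : Prop :=
  0 < s ∧ ∀ (N : ℕ) (τ : TaskSet N), τ.Positive → τ.IsDeadlineMonotonic → Feasible M τ →
    ∀ k : Fin N, test N M (τ.atSpeed s) k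

end Sporadic

end

/-!
Let every task release its jobs periodically from time `0` on.  A feasible task set then satisfies
`C k ≤ D k`, `U k ≤ 1`, `∑ i, U i ≤ M` and, since the deadlines of the tasks `i ≤ k` are at most
`D k`, also `∑ i ≤ k, C i ≤ M * D k`.  As the density of `τ k` is `C k / D k` or `U k`, the last two
bounds add up to `density k + ∑ i < k, (C i / D k + U i) ≤ 2 * M`.  At speed `s` the left-hand side
is at most `2 * M / s`, while all utilizations and densities are at most `1 / s`; so the density
test accepts as soon as `2 * M / s ≤ mu M (1 / s)`, that is, `3 - 1 / M ≤ s`.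

The density test implies the test over all `ℓ` and the closed-form test because the interference
relative to a window decreases with the length of the window.  For the remaining two tests take
`ρ = Umax k`: then no task `i < k` is heavy, and the workload of a task that is not heavy lies below
its linear bound, carry-in included.
-/

namespace Sporadic

open MeasureTheory Finset
open Filter (atTop eventually_ge_atTop tendsto_id)

section Feasibility

variable {M N : ℕ} {τ : TaskSet N}

theorem Schedule.service_eq_sum_restrict (σ : Schedule M N) (i : Fin N) (n : ℕ) (a b : ℝ) :
    σ.service i n a b = ∑ p, volume.restrict (Set.Ico a b) {t | σ.run p t = some (i, n)} := by
  simp only [Schedule.service, Measure.restrict_apply (σ.measurableSet_run _ i n)]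

theorem Schedule.service_mono (σ : Schedule M N) (i : Fin N) (n : ℕ) {a a' b b' : ℝ}
    (ha : a' ≤ a) (hb : b ≤ b') : σ.service i n a b ≤ σ.service i n a' b' :=
  sum_le_sum fun _ _ => measure_mono <|
    Set.inter_subset_inter_right _ (Set.Ico_subset_Ico ha hb)

theorem Schedule.tsum_service_le (σ : Schedule M N) (i : Fin N) (a b : ℝ) :
    ∑' n, σ.service i n a b ≤ ENNReal.ofReal (b - a) := by
  let E : ℕ × Fin M → Set ℝ := fun x => {t | σ.run x.2 t = some (i, x.1)}
  have hdisj : Pairwise (Function.onFun Disjoint E) := by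
    rintro ⟨n, p⟩ ⟨n', p'⟩ hne
    refine Set.disjoint_left.2 fun t (ht : σ.run p t = _) (ht' : σ.run p' t = _) => hne ?_
    obtain rfl := σ.no_parallelism t p p' i n n' ht ht'
    simpa using ht.symm.trans ht'
  calc ∑' n, σ.service i n a b
      = ∑' x, volume.restrict (Set.Ico a b) (E x) := by
        simp only [E, σ.service_eq_sum_restrict, ENNReal.tsum_prod', tsum_fintype]
    _ ≤ volume.restrict (Set.Ico a b) Set.univ :=
        tsum_measure_le_measure_univ
          (fun x => (σ.measurableSet_run x.2 i x.1).nullMeasurableSet)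
          fun _ _ hne => (hdisj hne).aedisjoint
    _ = ENNReal.ofReal (b - a) := by simp

theorem Schedule.sum_tsum_service_le (σ : Schedule M N) (a b : ℝ) :
    ∑ i, ∑' n, σ.service i n a b ≤ M * ENNReal.ofReal (b - a) := by
  let E : Fin M → Fin N × ℕ → Set ℝ := fun p j => {t | σ.run p t = some j}
  have hdisj (p : Fin M) : Pairwise (Function.onFun Disjoint (E p)) := fun j j' hne =>
    Set.disjoint_left.2 fun t (ht : σ.run p t = _) (ht' : σ.run p t = _) =>
      hne (Option.some.inj (ht.symm.trans ht'))
  have hproc (p : Fin M) : ∑' j, volume.restrict (Set.Ico a b) (E p j) ≤ ENNReal.ofReal (b - a) :=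
    (tsum_measure_le_measure_univ
      (fun j => (σ.measurableSet_run p j.1 j.2).nullMeasurableSet)
      fun _ _ hne => (hdisj p hne).aedisjoint).trans_eq (by simp)
  calc ∑ i, ∑' n, σ.service i n a b
      = ∑ p, ∑' j, volume.restrict (Set.Ico a b) (E p j) := by
        simp only [E, σ.service_eq_sum_restrict, ENNReal.tsum_prod', tsum_fintype,
          Summable.tsum_finsetSum fun _ _ => ENNReal.summable]
        exact sum_comm
    _ ≤ ∑ _p : Fin M, ENNReal.ofReal (b - a) := sum_le_sum fun p _ => hproc p
    _ = M * ENNReal.ofReal (b - a) := by simp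

/-- The demand bound function: the total execution time of the jobs of task `i`, released
periodically from time `0` on, that are due by time `L`.  Their number is `⌊(L - D i) / T i⌋ + 1`
for `D i ≤ L`; with `+ 1` inside the floor, truncation gives the correct value `0` for `L < D i`. -/
noncomputable def TaskSet.dbf (τ : TaskSet N) (i : Fin N) (L : ℝ) : ℝ :=
  ⌊(L - τ.D i) / τ.T i + 1⌋₊ * τ.C i

theorem TaskSet.Positive.dbf_nonneg (hpos : τ.Positive) (i : Fin N) (L : ℝ) : 0 ≤ τ.dbf i L :=
  mul_nonneg (Nat.cast_nonneg _) (hpos i).1.le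

theorem TaskSet.Positive.C_le_dbf (hpos : τ.Positive) {i : Fin N} {L : ℝ} (hL : τ.D i ≤ L) :
    τ.C i ≤ τ.dbf i L := by
  have hcount : 1 ≤ ⌊(L - τ.D i) / τ.T i + 1⌋₊ := Nat.le_floor <| by
    simpa using div_nonneg (sub_nonneg.2 hL) (hpos i).2.2.le
  exact le_mul_of_one_le_left (hpos i).1.le (by exact_mod_cast hcount)

theorem TaskSet.Positive.U_mul_sub_le_dbf (hpos : τ.Positive) (i : Fin N) (L : ℝ) :
    τ.U i * (L - τ.D i) ≤ τ.dbf i L :=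
  calc τ.U i * (L - τ.D i) = (L - τ.D i) / τ.T i * τ.C i := by rw [TaskSet.U]; ring
    _ ≤ τ.dbf i L := mul_le_mul_of_nonneg_right
        (by linarith [Nat.lt_floor_add_one ((L - τ.D i) / τ.T i + 1)]) (hpos i).1.le

theorem isLegalArrival_periodic (τ : TaskSet N) : IsLegalArrival τ fun i n => n * τ.T i :=
  fun i => ⟨by simp, fun n => by push_cast; linarith⟩

theorem Schedule.MeetsDeadlines.ofReal_dbf_le {σ : Schedule M N} (hpos : τ.Positive)
    (hσ : σ.MeetsDeadlines τ fun i n => n * τ.T i) (i : Fin N) (L : ℝ) :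
    ENNReal.ofReal (τ.dbf i L) ≤ ∑' n, σ.service i n 0 L := by
  obtain ⟨-, -, hT⟩ := hpos i
  have hserve : ∀ n ∈ range ⌊(L - τ.D i) / τ.T i + 1⌋₊,
      ENNReal.ofReal (τ.C i) ≤ σ.service i n 0 L := fun n hn => by
    have hdue : (n + 1 : ℝ) ≤ (L - τ.D i) / τ.T i + 1 := by
      exact_mod_cast (Nat.le_floor_iff' n.succ_ne_zero).1 (mem_range.1 hn)
    have hdeadline := (le_div_iff₀ hT).1 (le_of_add_le_add_right hdue)
    exact (hσ.2 i n).trans (σ.service_mono i n (by positivity) (by linarith))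
  calc ENNReal.ofReal (τ.dbf i L)
      = ∑ _n ∈ range ⌊(L - τ.D i) / τ.T i + 1⌋₊, ENNReal.ofReal (τ.C i) := by
        simp [TaskSet.dbf, ENNReal.ofReal_mul]
    _ ≤ ∑ n ∈ range ⌊(L - τ.D i) / τ.T i + 1⌋₊, σ.service i n 0 L := sum_le_sum hserve
    _ ≤ ∑' n, σ.service i n 0 L := ENNReal.sum_le_tsum _

theorem Feasible.dbf_le (h : Feasible M τ) (hpos : τ.Positive) (i : Fin N) {L : ℝ} (hL : 0 ≤ L) :
    τ.dbf i L ≤ L := by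
  obtain ⟨σ, hσ⟩ := h _ (isLegalArrival_periodic τ)
  have hle := (hσ.ofReal_dbf_le hpos i L).trans (σ.tsum_service_le i 0 L)
  rwa [sub_zero, ENNReal.ofReal_le_ofReal_iff hL] at hle

theorem Feasible.sum_dbf_le (h : Feasible M τ) (hpos : τ.Positive) {L : ℝ} (hL : 0 ≤ L) :
    ∑ i, τ.dbf i L ≤ M * L := by
  obtain ⟨σ, hσ⟩ := h _ (isLegalArrival_periodic τ)
  have hle := (sum_le_sum fun i _ => hσ.ofReal_dbf_le hpos i L).trans (σ.sum_tsum_service_le 0 L)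
  rwa [← ENNReal.ofReal_sum_of_nonneg fun i _ => hpos.dbf_nonneg i L, sub_zero,
    ← ENNReal.ofReal_natCast, ← ENNReal.ofReal_mul M.cast_nonneg,
    ENNReal.ofReal_le_ofReal_iff (by positivity)] at hle

theorem le_of_eventually_mul_sub_le_mul {K : Type*} [Field K] [LinearOrder K]
    [IsStrictOrderedRing K] {a b c : K} (h : ∀ᶠ x in atTop, a * x - c ≤ b * x) : a ≤ b := by
  by_contra! hlt
  have hunbounded : ∀ᶠ x in atTop, c < (a - b) * x :=
    (tendsto_id.const_mul_atTop (sub_pos.2 hlt)).eventually_gt_atTop c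
  obtain ⟨x, hle, hgt⟩ := (h.and hunbounded).exists
  linarith

theorem Feasible.U_le_one (h : Feasible M τ) (hpos : τ.Positive) (i : Fin N) : τ.U i ≤ 1 := by
  refine le_of_eventually_mul_sub_le_mul (c := τ.U i * τ.D i) ?_
  filter_upwards [eventually_ge_atTop 0] with L hL
  linarith [hpos.U_mul_sub_le_dbf i L, h.dbf_le hpos i hL]

theorem Feasible.C_le_D (h : Feasible M τ) (hpos : τ.Positive) (i : Fin N) : τ.C i ≤ τ.D i :=
  (hpos.C_le_dbf le_rfl).trans (h.dbf_le hpos i (hpos i).2.1.le)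

theorem Feasible.density_le_one (h : Feasible M τ) (hpos : τ.Positive) (i : Fin N) :
    τ.density i ≤ 1 := by
  obtain ⟨-, hD, hT⟩ := hpos i
  exact (div_le_one (lt_min hD hT)).2
    (le_min (h.C_le_D hpos i) ((div_le_one hT).1 (h.U_le_one hpos i)))

theorem Feasible.sum_U_le (h : Feasible M τ) (hpos : τ.Positive) : ∑ i, τ.U i ≤ M := by
  refine le_of_eventually_mul_sub_le_mul (c := ∑ i, τ.U i * τ.D i) ?_
  filter_upwards [eventually_ge_atTop 0] with L hL
  calc (∑ i, τ.U i) * L - ∑ i, τ.U i * τ.D i = ∑ i, τ.U i * (L - τ.D i) := by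
        simp only [mul_sub, sum_sub_distrib, sum_mul]
    _ ≤ ∑ i, τ.dbf i L := sum_le_sum fun i _ => hpos.U_mul_sub_le_dbf i L
    _ ≤ M * L := h.sum_dbf_le hpos hL

theorem Feasible.sum_C_le (h : Feasible M τ) (hpos : τ.Positive) {A : Finset (Fin N)} {L : ℝ}
    (hL : 0 ≤ L) (hA : ∀ i ∈ A, τ.D i ≤ L) : ∑ i ∈ A, τ.C i ≤ M * L :=
  calc ∑ i ∈ A, τ.C i ≤ ∑ i ∈ A, τ.dbf i L := sum_le_sum fun i hi => hpos.C_le_dbf (hA i hi)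
    _ ≤ ∑ i, τ.dbf i L := sum_le_univ_sum_of_nonneg fun i => hpos.dbf_nonneg i L
    _ ≤ M * L := h.sum_dbf_le hpos hL

end Feasibility

section Parameters

variable {N : ℕ} {τ : TaskSet N} {k : Fin N}

theorem TaskSet.Positive.U_pos (hpos : τ.Positive) (i : Fin N) : 0 < τ.U i :=
  div_pos (hpos i).1 (hpos i).2.2

theorem TaskSet.density_le_Umax : τ.density k ≤ τ.Umax k :=
  (le_fold_max _).2 (Or.inl le_rfl)

theorem TaskSet.U_le_Umax {i : Fin N} (hi : i ∈ Iio k) : τ.U i ≤ τ.Umax k :=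
  (le_fold_max _).2 (Or.inr ⟨i, hi, le_rfl⟩)

theorem TaskSet.Umax_le {c : ℝ} (hδ : τ.density k ≤ c) (hU : ∀ i < k, τ.U i ≤ c) :
    τ.Umax k ≤ c :=
  (fold_max_le _).2 ⟨hδ, fun i hi => hU i (mem_Iio.1 hi)⟩

theorem TaskSet.Positive.C_div_D_le_density (hpos : τ.Positive) : τ.C k / τ.D k ≤ τ.density k :=
  div_le_div_of_nonneg_left (hpos k).1.le (lt_min (hpos k).2.1 (hpos k).2.2) (min_le_left _ _)

theorem TaskSet.Positive.U_le_density (hpos : τ.Positive) : τ.U k ≤ τ.density k :=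
  div_le_div_of_nonneg_left (hpos k).1.le (lt_min (hpos k).2.1 (hpos k).2.2) (min_le_right _ _)

theorem TaskSet.Positive.D_le_window (hpos : τ.Positive) {ℓ : ℕ} (hℓ : 1 ≤ ℓ) :
    τ.D k ≤ τ.window k ℓ :=
  le_add_of_nonneg_left (mul_nonneg (sub_nonneg.2 (by exact_mod_cast hℓ)) (hpos k).2.2.le)

theorem TaskSet.Positive.window_pos (hpos : τ.Positive) {ℓ : ℕ} (hℓ : 1 ≤ ℓ) :
    0 < τ.window k ℓ :=
  (hpos k).2.1.trans_le (hpos.D_le_window hℓ)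

theorem TaskSet.Positive.mul_C_div_window_le_density (hpos : τ.Positive) {ℓ : ℕ} (hℓ : 1 ≤ ℓ) :
    ℓ * τ.C k / τ.window k ℓ ≤ τ.density k := by
  have hℓ' : (0 : ℝ) ≤ ℓ - 1 := sub_nonneg.2 (by exact_mod_cast hℓ)
  have hD : τ.C k ≤ τ.density k * τ.D k := (div_le_iff₀ (hpos k).2.1).1 hpos.C_div_D_le_density
  have hT : τ.C k ≤ τ.density k * τ.T k := (div_le_iff₀ (hpos k).2.2).1 hpos.U_le_density
  rw [div_le_iff₀ (hpos.window_pos hℓ)]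
  calc ℓ * τ.C k = (ℓ - 1) * τ.C k + τ.C k := by ring
    _ ≤ (ℓ - 1) * (τ.density k * τ.T k) + τ.density k * τ.D k := by gcongr
    _ = τ.density k * τ.window k ℓ := by rw [TaskSet.window]; ring

end Parameters

section Workload

variable {N : ℕ} {τ : TaskSet N} {i : Fin N}

/-- The linear upper bound `(C i - C i * U i) + U i * Δ` for the workload functions, as used by the
tests. -/
noncomputable def TaskSet.workBound (τ : TaskSet N) (i : Fin N) (Δ : ℝ) : ℝ :=
  τ.C i - τ.C i * τ.U i + τ.U i * Δ

theorem TaskSet.Positive.min_C_le_workBound (hpos : τ.Positive) (hU : τ.U i ≤ 1) (x : ℝ) :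
    min (τ.C i) x ≤ τ.workBound i x :=
  calc min (τ.C i) x ≤ (1 - τ.U i) • τ.C i + τ.U i • x :=
        Convex.min_le_combo _ _ (sub_nonneg.2 hU) (hpos.U_pos i).le (sub_add_cancel _ _)
    _ = τ.workBound i x := by simp only [TaskSet.workBound, smul_eq_mul]; ring

theorem TaskSet.Positive.workBound_add_mul_T (hpos : τ.Positive) (x y : ℝ) :
    τ.workBound i (x + y * τ.T i) = τ.workBound i x + y * τ.C i := by
  have hUT : τ.U i * τ.T i = τ.C i := div_mul_cancel₀ _ (hpos i).2.2.ne'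
  simp only [TaskSet.workBound]
  linear_combination y * hUT

theorem TaskSet.Positive.work_le_workBound (hpos : τ.Positive) (hU : τ.U i ≤ 1) (Δ : ℝ) :
    τ.work i Δ ≤ τ.workBound i Δ := by
  set m : ℝ := (⌊Δ / τ.T i⌋ : ℝ)
  calc τ.work i Δ = min (τ.C i) (Δ - m * τ.T i) + m * τ.C i := add_comm _ _
    _ ≤ τ.workBound i (Δ - m * τ.T i) + m * τ.C i := by gcongr; exact hpos.min_C_le_workBound hU _
    _ = τ.workBound i Δ := by rw [← hpos.workBound_add_mul_T, sub_add_cancel]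

theorem sub_ceil_div_sub_one_mul_mem_Ioc {K : Type*} [Field K] [LinearOrder K]
    [IsStrictOrderedRing K] [FloorRing K] {p : K} (hp : 0 < p) (x : K) :
    x - (⌈x / p⌉ - 1) * p ∈ Set.Ioc 0 p := by
  have hlt := (lt_div_iff₀ hp).1 (sub_lt_iff_lt_add.2 (Int.ceil_lt_add_one (x / p)))
  have hle := (div_le_iff₀ hp).1 (Int.le_ceil (x / p))
  exact ⟨sub_pos.2 hlt, by linarith⟩

theorem TaskSet.Positive.light_le_workBound (hpos : τ.Positive) {ρ : ℝ} (hU : τ.U i ≤ 1)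
    (hρ : τ.U i ≤ ρ) (Δ : ℝ) : τ.light i ρ Δ ≤ τ.workBound i Δ := by
  unfold TaskSet.light
  split_ifs with hΔ
  · simpa only [min_eq_right hΔ] using hpos.min_C_le_workBound hU Δ
  · refine max_le (hpos.work_le_workBound hU Δ) ?_
    set p : ℝ := ⌈(Δ - τ.C i) / τ.T i⌉ - 1
    set q : ℝ := Δ - τ.C i - p * τ.T i with hq
    obtain ⟨hq0, hqT⟩ : q ∈ Set.Ioc 0 (τ.T i) :=
      sub_ceil_div_sub_one_mul_mem_Ioc (hpos i).2.2 (Δ - τ.C i)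
    have hUT : τ.U i * τ.T i = τ.C i := div_mul_cancel₀ _ (hpos i).2.2.ne'
    have hcarry : max 0 (τ.C i - ρ * (τ.T i - q)) ≤ τ.U i * q := by
      refine max_le (mul_nonneg (hpos.U_pos i).le hq0.le) ?_
      linarith [mul_le_mul_of_nonneg_right hρ (sub_nonneg.2 hqT)]
    calc (p + 1) * τ.C i + max 0 (τ.C i - ρ * (τ.T i - q))
        ≤ (p + 1) * τ.C i + τ.U i * q := by gcongr
      _ = τ.workBound i (τ.C i + q) + p * τ.C i := by simp only [TaskSet.workBound]; ring
      _ = τ.workBound i Δ := by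
        rw [← hpos.workBound_add_mul_T, hq]
        congr 1
        ring

theorem TaskSet.Positive.omegaDiff_le (hpos : τ.Positive) {ρ : ℝ} (hU : τ.U i ≤ 1)
    (hρ : τ.U i ≤ ρ) (Δ : ℝ) : τ.omegaDiff i ρ Δ ≤ τ.workBound i Δ - τ.work i Δ := by
  rw [TaskSet.omegaDiff, if_neg hρ.not_gt]
  exact sub_le_sub_right (hpos.light_le_workBound hU hρ Δ) _

theorem TaskSet.Positive.sum_omegaDiff_add_sum_work_le (hpos : τ.Positive) {ρ : ℝ}
    {A S : Finset (Fin N)} (hSA : S ⊆ A) (hU : ∀ i ∈ A, τ.U i ≤ 1) (hρ : ∀ i ∈ A, τ.U i ≤ ρ)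
    (Δ : ℝ) : ∑ i ∈ S, τ.omegaDiff i ρ Δ + ∑ i ∈ A, τ.work i Δ ≤ ∑ i ∈ A, τ.workBound i Δ := by
  rw [← le_sub_iff_add_le, ← sum_sub_distrib]
  calc ∑ i ∈ S, τ.omegaDiff i ρ Δ ≤ ∑ i ∈ S, (τ.workBound i Δ - τ.work i Δ) :=
        sum_le_sum fun i hi => hpos.omegaDiff_le (hU i (hSA hi)) (hρ i (hSA hi)) Δ
    _ ≤ ∑ i ∈ A, (τ.workBound i Δ - τ.work i Δ) :=
        sum_le_sum_of_subset_of_nonneg hSA fun i hi _ =>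
          sub_nonneg.2 (hpos.work_le_workBound (hU i hi) Δ)

end Workload

section Interference

variable {N : ℕ} {τ : TaskSet N} {k : Fin N}

/-- The interference sum of the tests: the linear workload bounds of the tasks `i < k` over a window
of length `W`, relative to `W`. -/
noncomputable def TaskSet.interference (τ : TaskSet N) (k : Fin N) (W : ℝ) : ℝ :=
  ∑ i ∈ Iio k, ((τ.C i - τ.C i * τ.U i) / W + τ.U i)

theorem TaskSet.mul_interference {W : ℝ} (hW : W ≠ 0) :
    W * τ.interference k W = ∑ i ∈ Iio k, τ.workBound i W := by
  rw [TaskSet.interference, mul_sum]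
  refine sum_congr rfl fun i _ => ?_
  rw [TaskSet.workBound]
  field_simp

theorem TaskSet.Positive.C_sub_C_mul_U_nonneg (hpos : τ.Positive) {i : Fin N} (hU : τ.U i ≤ 1) :
    0 ≤ τ.C i - τ.C i * τ.U i :=
  sub_nonneg.2 (mul_le_of_le_one_right (hpos i).1.le hU)

theorem TaskSet.Positive.interference_antitoneOn (hpos : τ.Positive)
    (hU : ∀ i ∈ Iio k, τ.U i ≤ 1) : AntitoneOn (τ.interference k) (Set.Ioi 0) :=
  fun _ hW _ _ hle => sum_le_sum fun i hi => by
    gcongr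
    exact hpos.C_sub_C_mul_U_nonneg (hU i hi)

theorem TaskSet.Positive.sum_U_le_interference (hpos : τ.Positive) (hU : ∀ i ∈ Iio k, τ.U i ≤ 1)
    {W : ℝ} (hW : 0 ≤ W) : ∑ i ∈ Iio k, τ.U i ≤ τ.interference k W :=
  sum_le_sum fun i hi => le_add_of_nonneg_left (div_nonneg (hpos.C_sub_C_mul_U_nonneg (hU i hi)) hW)

theorem TaskSet.Positive.interference_le (hpos : τ.Positive) {W : ℝ} (hW : 0 ≤ W) :
    τ.interference k W ≤ (∑ i ∈ Iio k, τ.C i) / W + ∑ i ∈ Iio k, τ.U i := by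
  rw [sum_div, ← sum_add_distrib]
  refine sum_le_sum fun i _ => ?_
  gcongr
  exact sub_le_self _ (mul_pos (hpos i).1 (hpos.U_pos i)).le

end Interference

section Tests

variable {N M : ℕ} {τ : TaskSet N} {k : Fin N}

theorem exists_isLargest {ι : Type*} (A : Finset ι) (f : ι → ℝ) (m : ℕ) :
    ∃ S, IsLargest A f m S := by
  classical
  induction m with
  | zero => exact ⟨∅, by simp [IsLargest]⟩
  | succ m ih =>
    obtain ⟨S, hSA, hcard, hS⟩ := ih
    obtain hAS | hne := (A \ S).eq_empty_or_nonempty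
    · obtain rfl := hSA.antisymm (sdiff_eq_empty_iff_subset.1 hAS)
      exact ⟨S, hSA, by omega, hS⟩
    · obtain ⟨x, hx, hmax⟩ := exists_max_image (A \ S) f hne
      obtain ⟨hxA, hxS⟩ := mem_sdiff.1 hx
      have hlt : S.card < A.card := card_lt_card ⟨hSA, fun h => hxS (h hxA)⟩
      refine ⟨insert x S, insert_subset hxA hSA, ?_, fun i hi j hj hjS => ?_⟩
      · rw [card_insert_of_notMem hxS]
        omega
      · replace hjS : j ∉ S := fun h => hjS (mem_insert_of_mem h)
        obtain rfl | hi := mem_insert.1 hi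
        · exact hmax j (mem_sdiff.2 ⟨hj, hjS⟩)
        · exact hS i hi j hj hjS

theorem densityTest.closedFormTest (h : densityTest N M τ k) (hpos : τ.Positive)
    (hmax : τ.Umax k ≤ 1) : closedFormTest N M τ k := by
  refine ⟨fun _ => ?_, fun _ => (add_le_add_left hpos.C_div_D_le_density _).trans h⟩
  rw [← Iio_insert, sum_insert (by simp)]
  exact (add_le_add hpos.U_le_density (hpos.sum_U_le_interference
    (fun i hi => (TaskSet.U_le_Umax hi).trans hmax) (hpos k).2.1.le)).trans h

theorem densityTest.allEllTest (h : densityTest N M τ k) (hpos : τ.Positive)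
    (hmax : τ.Umax k ≤ 1) : allEllTest N M τ k := fun _ hℓ =>
  (add_le_add (hpos.mul_C_div_window_le_density hℓ) (hpos.interference_antitoneOn
    (fun _ hi => (TaskSet.U_le_Umax hi).trans hmax) (hpos k).2.1 (hpos.window_pos hℓ)
    (hpos.D_le_window hℓ))).trans h

theorem allEllTest.linearApproxTest (h : allEllTest N M τ k) (hpos : τ.Positive)
    (hmax : τ.Umax k ≤ 1) : linearApproxTest N M τ k := by
  refine fun ℓ hℓ => ⟨τ.Umax k, hmax,
    (hpos.mul_C_div_window_le_density hℓ).trans TaskSet.density_le_Umax, ?_⟩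
  obtain ⟨S, hS⟩ := exists_isLargest (Iio k)
    (fun i => τ.gamma i (τ.Umax k) * τ.U i * τ.D i) (⌈mu M (τ.Umax k)⌉₊ - 1)
  refine ⟨S, hS, ?_⟩
  have hcarry : ∑ i ∈ S, τ.gamma i (τ.Umax k) * τ.U i * τ.D i / τ.window k ℓ = 0 :=
    sum_eq_zero fun i hi => by simp [TaskSet.gamma, (TaskSet.U_le_Umax (hS.1 hi)).not_gt]
  rw [hcarry, add_zero]
  exact h ℓ hℓ

theorem allEllTest.mul_C_add_sum_workBound_le (h : allEllTest N M τ k) (hpos : τ.Positive)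
    (hmax : τ.Umax k ≤ 1) {ℓ : ℕ} (hℓ : 1 ≤ ℓ) {Δ : ℝ} (hΔ : τ.window k ℓ ≤ Δ) :
    ℓ * τ.C k + ∑ i ∈ Iio k, τ.workBound i Δ ≤ Δ * mu M (τ.Umax k) := by
  have hW : 0 < τ.window k ℓ := hpos.window_pos hℓ
  have hΔ0 : 0 < Δ := hW.trans_le hΔ
  have hC := (hpos k).1
  calc ℓ * τ.C k + ∑ i ∈ Iio k, τ.workBound i Δ
      = Δ * (ℓ * τ.C k / Δ + τ.interference k Δ) := by
        rw [mul_add, mul_div_cancel₀ _ hΔ0.ne', TaskSet.mul_interference hΔ0.ne']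
    _ ≤ Δ * (ℓ * τ.C k / τ.window k ℓ + τ.interference k (τ.window k ℓ)) := by
        gcongr
        exact hpos.interference_antitoneOn (fun i hi => (TaskSet.U_le_Umax hi).trans hmax) hW hΔ0 hΔ
    _ ≤ Δ * mu M (τ.Umax k) := mul_le_mul_of_nonneg_left (h ℓ hℓ) hΔ0.le

theorem allEllTest.workloadTest (h : allEllTest N M τ k) (hpos : τ.Positive)
    (hmax : τ.Umax k ≤ 1) : workloadTest N M τ k := by
  refine fun ℓ hℓ => ⟨τ.Umax k, hmax,
    (hpos.mul_C_div_window_le_density hℓ).trans TaskSet.density_le_Umax, fun Δ hΔ => ?_⟩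
  obtain ⟨S, hS⟩ := exists_isLargest (Iio k)
    (fun i => τ.omegaDiff i (τ.Umax k) Δ) (⌈mu M (τ.Umax k)⌉₊ - 1)
  refine ⟨S, hS, ?_⟩
  have hworkload := hpos.sum_omegaDiff_add_sum_work_le hS.1
    (fun i hi => (TaskSet.U_le_Umax hi).trans hmax) (fun i hi => TaskSet.U_le_Umax hi) Δ
  linarith [h.mul_C_add_sum_workBound_le hpos hmax hℓ hΔ]

end Tests

section Speedup

variable {M N : ℕ} {τ : TaskSet N} {s : ℝ}

theorem TaskSet.Positive.atSpeed (hpos : τ.Positive) (hs : 0 < s) : (τ.atSpeed s).Positive :=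
  fun i => ⟨div_pos (hpos i).1 hs, (hpos i).2⟩

theorem TaskSet.U_atSpeed (τ : TaskSet N) (s : ℝ) (i : Fin N) : (τ.atSpeed s).U i = τ.U i / s :=
  div_right_comm _ _ _

theorem TaskSet.density_atSpeed (τ : TaskSet N) (s : ℝ) (i : Fin N) :
    (τ.atSpeed s).density i = τ.density i / s :=
  div_right_comm _ _ _

theorem Feasible.Umax_atSpeed_le (h : Feasible M τ) (hpos : τ.Positive) (hs : 0 < s) (k : Fin N) :
    (τ.atSpeed s).Umax k ≤ 1 / s := by
  refine TaskSet.Umax_le ?_ fun i _ => ?_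
  · rw [τ.density_atSpeed]
    exact div_le_div_of_nonneg_right (h.density_le_one hpos k) hs.le
  · rw [τ.U_atSpeed]
    exact div_le_div_of_nonneg_right (h.U_le_one hpos i) hs.le

theorem TaskSet.Positive.interference_atSpeed_le (hpos : τ.Positive) (hs : 0 < s) {W : ℝ}
    (hW : 0 ≤ W) (k : Fin N) : (τ.atSpeed s).interference k W ≤
      ((∑ i ∈ Iio k, τ.C i) / W + ∑ i ∈ Iio k, τ.U i) / s :=
  ((hpos.atSpeed hs).interference_le hW).trans_eq <| by
    simp only [TaskSet.U_atSpeed]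
    simp only [TaskSet.atSpeed, ← sum_div]
    ring

theorem Feasible.density_add_sum_le (h : Feasible M τ) (hpos : τ.Positive)
    (hDM : τ.IsDeadlineMonotonic) (k : Fin N) :
    τ.density k + ((∑ i ∈ Iio k, τ.C i) / τ.D k + ∑ i ∈ Iio k, τ.U i) ≤ 2 * M := by
  obtain ⟨hC, hD, -⟩ := hpos k
  have hsumC : τ.C k / τ.D k + (∑ i ∈ Iio k, τ.C i) / τ.D k ≤ M := by
    rw [← add_div, div_le_iff₀ hD, ← sum_insert (by simp), Iio_insert]
    refine h.sum_C_le hpos hD.le fun i hi => ?_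
    obtain rfl | hlt := (mem_Iic.1 hi).eq_or_lt
    exacts [le_rfl, hDM i k hlt]
  have hsumU : τ.U k + ∑ i ∈ Iio k, τ.U i ≤ M := by
    rw [← sum_insert (by simp)]
    exact (sum_le_univ_sum_of_nonneg fun i => (hpos.U_pos i).le).trans (h.sum_U_le hpos)
  have hdensity : τ.density k ≤ τ.C k / τ.D k + τ.U k := by
    have hCD := (div_pos hC hD).le
    have hUk := (hpos.U_pos k).le
    obtain hmin | hmin := min_choice (τ.D k) (τ.T k) <;> rw [TaskSet.density, hmin]
    exacts [le_add_of_nonneg_right hUk, le_add_of_nonneg_left hCD]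
  linarith

theorem mu_antitone (hM : 1 ≤ M) : Antitone (mu M) := fun _ _ hle =>
  sub_le_sub_left
    (mul_le_mul_of_nonneg_left hle (sub_nonneg.2 (by exact_mod_cast hM))) _

theorem one_le_of_three_sub_inv_le (hM : 1 ≤ M) (hs : 3 - 1 / (M : ℝ) ≤ s) : 1 ≤ s := by
  have hinv : 1 / (M : ℝ) ≤ 1 := div_le_one_of_le₀ (by exact_mod_cast hM) M.cast_nonneg
  linarith

theorem two_mul_div_le_mu_one_div (hM : 1 ≤ M) (hs : 3 - 1 / (M : ℝ) ≤ s) :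
    2 * M / s ≤ mu M (1 / s) := by
  have hs0 : 0 < s := zero_lt_one.trans_le (one_le_of_three_sub_inv_le hM hs)
  have hM0 : (0 : ℝ) < M := by exact_mod_cast hM
  have hsM : 3 * M - 1 ≤ s * M :=
    calc 3 * M - 1 = (3 - 1 / (M : ℝ)) * M := by rw [sub_mul, div_mul_cancel₀ 1 hM0.ne']
      _ ≤ s * M := by gcongr
  rw [div_le_iff₀ hs0, mu, sub_mul, mul_assoc, one_div_mul_cancel hs0.ne']
  linarith

theorem Feasible.densityTest_atSpeed (h : Feasible M τ) (hpos : τ.Positive)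
    (hDM : τ.IsDeadlineMonotonic) (hM : 1 ≤ M) (hs : 3 - 1 / (M : ℝ) ≤ s) (k : Fin N) :
    densityTest N M (τ.atSpeed s) k := by
  have hs0 : 0 < s := zero_lt_one.trans_le (one_le_of_three_sub_inv_le hM hs)
  calc (τ.atSpeed s).density k + (τ.atSpeed s).interference k (τ.D k)
      ≤ τ.density k / s + ((∑ i ∈ Iio k, τ.C i) / τ.D k + ∑ i ∈ Iio k, τ.U i) / s := by
        rw [τ.density_atSpeed]
        gcongr
        exact hpos.interference_atSpeed_le hs0 (hpos k).2.1.le k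
    _ = (τ.density k + ((∑ i ∈ Iio k, τ.C i) / τ.D k + ∑ i ∈ Iio k, τ.U i)) / s :=
        (add_div _ _ _).symm
    _ ≤ 2 * M / s := by gcongr; exact h.density_add_sum_le hpos hDM k
    _ ≤ mu M (1 / s) := two_mul_div_le_mu_one_div hM hs
    _ ≤ mu M ((τ.atSpeed s).Umax k) := mu_antitone hM (h.Umax_atSpeed_le hpos hs0 k)

theorem HasSpeedupBoundDM.mono {test test' : (N M : ℕ) → TaskSet N → Fin N → Prop}
    (h : HasSpeedupBoundDM M test s)
    (himp : ∀ {N : ℕ} {τ : TaskSet N} {k : Fin N}, τ.Positive → test N M τ k → test' N M τ k) :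
    HasSpeedupBoundDM M test' s :=
  ⟨h.1, fun N τ hpos hDM hfeas k => himp (hpos.atSpeed h.1) (h.2 N τ hpos hDM hfeas k)⟩

theorem hasSpeedupBoundDM_densityTest_and_Umax_le_one (hM : 1 ≤ M) (hs : 3 - 1 / (M : ℝ) ≤ s) :
    HasSpeedupBoundDM M (fun N M τ k => densityTest N M τ k ∧ τ.Umax k ≤ 1) s := by
  have hs1 : 1 ≤ s := one_le_of_three_sub_inv_le hM hs
  have hs0 : 0 < s := zero_lt_one.trans_le hs1
  exact ⟨hs0, fun N τ hpos hDM hfeas k => ⟨hfeas.densityTest_atSpeed hpos hDM hM hs k,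
    (hfeas.Umax_atSpeed_le hpos hs0 k).trans ((div_le_one hs0).2 hs1)⟩⟩

end Speedup

end Sporadic

theorem theorem5p3_general {M : ℕ} (hM : 1 ≤ M) {s : ℝ} (hs : 3 - 1 / (M : ℝ) ≤ s) :
    Sporadic.HasSpeedupBoundDM M Sporadic.workloadTest s ∧
    Sporadic.HasSpeedupBoundDM M Sporadic.linearApproxTest s ∧
    Sporadic.HasSpeedupBoundDM M Sporadic.allEllTest s ∧
    Sporadic.HasSpeedupBoundDM M Sporadic.closedFormTest s ∧
    Sporadic.HasSpeedupBoundDM M Sporadic.densityTest s := by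
  have h := Sporadic.hasSpeedupBoundDM_densityTest_and_Umax_le_one hM hs
  have hall : Sporadic.HasSpeedupBoundDM M
      (fun N M τ k => Sporadic.allEllTest N M τ k ∧ τ.Umax k ≤ 1) s :=
    h.mono fun hpos ⟨hd, hmax⟩ => ⟨hd.allEllTest hpos hmax, hmax⟩
  exact ⟨hall.mono fun hpos ⟨ht, hmax⟩ => ht.workloadTest hpos hmax,
    hall.mono fun hpos ⟨ht, hmax⟩ => ht.linearApproxTest hpos hmax,
    hall.mono fun _ ht => ht.1,
    h.mono fun hpos ⟨hd, hmax⟩ => hd.closedFormTest hpos hmax,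
    h.mono fun _ hd => hd.1⟩

theorem theorem5p3 (M : ℕ) (hM : 2 ≤ M) :
    Sporadic.HasSpeedupBoundDM M Sporadic.workloadTest (3 - 1 / (M : ℝ)) ∧
    Sporadic.HasSpeedupBoundDM M Sporadic.linearApproxTest (3 - 1 / (M : ℝ)) ∧
    Sporadic.HasSpeedupBoundDM M Sporadic.allEllTest (3 - 1 / (M : ℝ)) ∧
    Sporadic.HasSpeedupBoundDM M Sporadic.closedFormTest (3 - 1 / (M : ℝ)) ∧
    Sporadic.HasSpeedupBoundDM M Sporadic.densityTest (3 - 1 / (M : ℝ)) :=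
  theorem5p3_general (one_le_two.trans hM) le_rfl
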